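/- **Setting.** Let $\mathbb F$ be an algebraically closed field. The degree of a polynomial row vector, or of a polynomial matrix, is the largest degree of its entries; a linear polynomial matrix is one whose entries have degree at most $1$. For a polynomial matrix $G(\lambda)$ of degree at most $g$ put $\operatorname{rev}_gG(\lambda)=\lambda^gG(1/\lambda)$. A minimal basis of a subspace $\mathcal V\subseteq\mathbb F(\lambda)^{1\times n}$ is a basis of $\mathcal V$ consisting of polynomial vectors whose sum of degrees is least among all polynomial bases of $\mathcal V$; the ordered list of its degrees depends only on $\mathcal V$ and is the list of minimal indices of $\mathcal V$. The left minimal bases and left minimal indices of a rational matrix $G(\lambda)$ are those of its left null-space $\{y(\lambda)^T : y(\lambda)^TG(\lambda)=0\}$. A polynomial matrix is called a minimal basis if its rows are a minimal basis of their span. Two minimal bases $K(\lambda)\in\mathbb F[\lambda]^{k\times c}$ and $N(\lambda)\in\mathbb F[\lambda]^{q\times c}$ are dual if $k+q=c$ and $K(\lambda)N(\lambda)^T=0$. A linear polynomial matrix $L(\lambda)=\begin{bmatrix}M(\lambda)\\K(\lambda)\end{bmatrix}$ is a strong block minimal basis pencil if $K(\lambda)$ is a minimal basis (possibly with no rows)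 all of whose row degrees are $1$, and a minimal basis dual to $K(\lambda)$ has all its row degrees equal; it is associated with $P(\lambda)$, through the minimal basis $N(\lambda)$ dual to $K(\lambda)$, if $M(\lambda)N(\lambda)^T=P(\lambda)$. **Theorem.** Let $R(\lambda)=D(\lambda)+C(\lambda)A(\lambda)^{-1}B(\lambda)\in\mathbb F(\lambda)^{p\times m}$ with polynomial matrices $A(\lambda)\in\mathbb F[\lambda]^{n\times n}$, $\det A(\lambda)\not\equiv0$, $B(\lambda)\in\mathbb F[\lambda]^{n\times m}$, $C(\lambda)\in\mathbb F[\lambda]^{p\times n}$ and $D(\lambda)\in\mathbb F[\lambda]^{p\times m}$. Let $$L_A(\lambda)=\begin{bmatrix}M_A(\lambda)\\K_A(\lambda)\end{bmatrix},\qquad L_D(\lambda)=\begin{bmatrix}M_D(\lambda)\\K_D(\lambda)\end{bmatrix}$$ be strong block minimal basis pencils associated with $A(\lambda)$ and $D(\lambda)$ through minimal bases $N_A(\lambda)$ (with $n$ rows) and $N_D(\lambda)$ (with $m$ rows) dual to $K_A(\lambda)$ and $K_D(\lambda)$: $M_AN_A^T=A$ and $M_DN_D^T=D$. Put $\rho_i=\deg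 N_i(\lambda)$ for $i\in\{A,D\}$. Let $M_B(\lambda)$, $M_C(\lambda)$ be linear polynomial matrices with $M_B(\lambda)N_D(\lambda)^T=B(\lambda)$ and $M_C(\lambda)N_A(\lambda)^T=C(\lambda)$. Consider the linear polynomial system matrix $$\mathcal L(\lambda)=\left[\begin{array}{c|c}M_A(\lambda)&M_B(\lambda)\\K_A(\lambda)&0\\\hline -M_C(\lambda)&M_D(\lambda)\\0&K_D(\lambda)\end{array}\right]$$ with state matrix $L_A(\lambda)$, and its transfer function matrix $$\widehat R(\lambda)=\begin{bmatrix}M_D(\lambda)\\K_D(\lambda)\end{bmatrix}+\begin{bmatrix}M_C(\lambda)\\0\end{bmatrix}L_A(\lambda)^{-1}\begin{bmatrix}M_B(\lambda)\\0\end{bmatrix}.$$ Assume that $$\operatorname{rank}\begin{bmatrix}A(\lambda_0)&B(\lambda_0)\end{bmatrix}=n\ \text{ for all }\lambda_0\in\mathbb F,\qquad \operatorname{rank}\begin{bmatrix}\operatorname{rev}_{\rho_A+1}A(0)&\operatorname{rev}_{\rho_D+1}B(0)\end{bmatrix}=n.$$ Then: (a) If $\{z_i(\lambda)^T\}_{i=1}^t$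 is a left minimal basis of $\mathcal L(\lambda)$, partitioned as $z_i(\lambda)^T=\begin{bmatrix}y_i(\lambda)^T&x_i(\lambda)^T\end{bmatrix}$ conformably with the two block rows of $\mathcal L(\lambda)$ separated by the line, and $x_i(\lambda)^T=\begin{bmatrix}u_i(\lambda)^T&w_i(\lambda)^T\end{bmatrix}$ with $u_i(\lambda)^T$ of length $p$, then $\{x_i(\lambda)^T\}_{i=1}^t$ is a left minimal basis of $\widehat R(\lambda)$ and $\{u_i(\lambda)^T\}_{i=1}^t$ is a left minimal basis of $R(\lambda)$. (b) The left minimal indices of $\mathcal L(\lambda)$, of $\widehat R(\lambda)$ and of $R(\lambda)$ coincide: a list $\eta_1\le\cdots\le\eta_t$ is the list of left minimal indices of $\mathcal L(\lambda)$ if and only if it is that of $\widehat R(\lambda)$, and if and only if it is that of $R(\lambda)$. -/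

import Mathlib

/-!  Matrix polynomials are matrices over `Polynomial F`, rational matrices are matrices over
`RatFunc F`, and a finite family of (row) vectors is the matrix that has them as its rows. -/

namespace RationalMatrix

open Matrix

variable {F : Type*} [Field F]

/-- A polynomial matrix regarded as a rational matrix. -/
noncomputable def toRat {α β : Type*} (G : Matrix α β (Polynomial F)) : Matrix α β (RatFunc F) :=
  G.map (algebraMap (Polynomial F) (RatFunc F))

/-- The constant matrix `G(x)`. -/
noncomputable def evalAt {α β : Type*} (x : F) (G : Matrix α β (Polynomial F)) : Matrix α β F :=
  G.map (Polynomial.eval x)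

/-- The degree of the `i`-th row: the largest degree of its entries. -/
noncomputable def rowDegree {α β : Type*} [Fintype β] (G : Matrix α β (Polynomial F)) (i : α) : ℕ :=
  Finset.univ.sup fun j => (G i j).natDegree

/-- The degree of a polynomial matrix: the largest degree of its entries. -/
noncomputable def matDegree {α β : Type*} [Fintype α] [Fintype β]
    (G : Matrix α β (Polynomial F)) : ℕ :=
  Finset.univ.sup fun i => rowDegree G i

/-- A linear polynomial matrix (a pencil): every entry has degree at most one. -/
def IsPencil {α β : Type*} (G : Matrix α β (Polynomial F)) : Prop :=
  ∀ i j, (G i j).natDegree ≤ 1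

/-- The `g`-reversal `λ ^ g * G(1/λ)` of a polynomial matrix of degree at most `g`:
the coefficient of `λ ^ k` becomes the coefficient of `λ ^ (g - k)`. -/
noncomputable def rev {α β : Type*} (g : ℕ) (G : Matrix α β (Polynomial F)) :
    Matrix α β (Polynomial F) :=
  G.map (Polynomial.reflect g)

/-- The rows of `Z` form a basis of the rational subspace `V` (polynomial since `Z` is). -/
def IsPolynomialBasis {κ ι : Type*} (V : Submodule (RatFunc F) (ι → RatFunc F))
    (Z : Matrix κ ι (Polynomial F)) : Prop :=
  LinearIndependent (RatFunc F) (toRat Z).row ∧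
    Submodule.span (RatFunc F) (Set.range (toRat Z).row) = V

/-- The rows of `Z` form a minimal basis of the rational subspace `V`: a polynomial basis whose
sum of degrees is least among all polynomial bases of `V` (these all have the same size). -/
def IsMinimalBasisOf {κ ι : Type*} [Fintype κ] [Fintype ι]
    (V : Submodule (RatFunc F) (ι → RatFunc F)) (Z : Matrix κ ι (Polynomial F)) : Prop :=
  IsPolynomialBasis V Z ∧
    ∀ Y : Matrix κ ι (Polynomial F), IsPolynomialBasis V Y →
      ∑ i, rowDegree Z i ≤ ∑ i, rowDegree Y i

/-- A polynomial matrix is a minimal basis if its rows are a minimal basis of their span. -/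
def IsMinimalBasis {κ ι : Type*} [Fintype κ] [Fintype ι] (Z : Matrix κ ι (Polynomial F)) : Prop :=
  IsMinimalBasisOf (Submodule.span (RatFunc F) (Set.range (toRat Z).row)) Z

/-- `η 0 ≤ η 1 ≤ ...` are the minimal indices of `V`: `V` has a minimal basis, and the ordered list
of the degrees of any minimal basis of `V` is `η`. -/
def IsMinimalIndices {ι : Type*} [Fintype ι] (V : Submodule (RatFunc F) (ι → RatFunc F))
    {t : ℕ} (η : Fin t → ℕ) : Prop :=
  Monotone η ∧ (∃ Z : Matrix (Fin t) ι (Polynomial F), IsMinimalBasisOf V Z) ∧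
    ∀ Z : Matrix (Fin t) ι (Polynomial F), IsMinimalBasisOf V Z →
      ∃ σ : Equiv.Perm (Fin t), ∀ i, rowDegree Z (σ i) = η i

/-- The left null-space of a rational matrix: all row vectors `y` with `y G = 0`. -/
noncomputable def leftNullspace {α β : Type*} [Fintype α] (G : Matrix α β (RatFunc F)) :
    Submodule (RatFunc F) (α → RatFunc F) :=
  LinearMap.ker G.vecMulLinear

/-- The rows of `Z` are a left minimal basis of the rational matrix `G`. -/
def IsLeftMinimalBasis {κ α β : Type*} [Fintype κ] [Fintype α]
    (G : Matrix α β (RatFunc F)) (Z : Matrix κ α (Polynomial F)) : Prop :=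
  IsMinimalBasisOf (leftNullspace G) Z

/-- `η` lists the left minimal indices of the rational matrix `G` in increasing order. -/
def IsLeftMinimalIndices {α β : Type*} [Fintype α] (G : Matrix α β (RatFunc F))
    {t : ℕ} (η : Fin t → ℕ) : Prop :=
  IsMinimalIndices (leftNullspace G) η

/-- `K` and `N` are dual minimal bases. -/
structure IsDualMinimalBasis {κ ν ι : Type*} [Fintype κ] [Fintype ν] [Fintype ι]
    (K : Matrix κ ι (Polynomial F)) (N : Matrix ν ι (Polynomial F)) : Prop where
  minimal_left : IsMinimalBasis K
  minimal_right : IsMinimalBasis N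
  card_add_card : Fintype.card κ + Fintype.card ν = Fintype.card ι
  mul_transpose : K * Nᵀ = 0

/-- The block column with blocks `M` and `K` is a (one block column) strong block minimal basis
pencil: it is a pencil, `K` is a minimal basis all of whose row degrees equal one, and `K` has a
dual minimal basis whose row degrees are all equal. -/
structure IsStrongBlockMinimalBasisPencil {α κ ι : Type*} [Fintype κ] [Fintype ι]
    (M : Matrix α ι (Polynomial F)) (K : Matrix κ ι (Polynomial F)) : Prop where
  pencil : IsPencil (fromRows M K)
  minimal : IsMinimalBasis K
  rowDegree_eq_one : ∀ i, rowDegree K i = 1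
  dual_rowDegree_eq : ∃ (q : ℕ) (N : Matrix (Fin q) ι (Polynomial F)),
    IsDualMinimalBasis K N ∧ ∀ i j, rowDegree N i = rowDegree N j

/-- The polynomial system matrix with blocks `A`, `B`, `-C`, `D` and state matrix `A`. -/
noncomputable def systemMatrix {ν α β : Type*} (A : Matrix ν ν (Polynomial F)) (B : Matrix ν β (Polynomial F))
    (C : Matrix α ν (Polynomial F)) (D : Matrix α β (Polynomial F)) :
    Matrix (ν ⊕ α) (ν ⊕ β) (Polynomial F) :=
  fromBlocks A B (-C) D

/-- The transfer function matrix `D + C A⁻¹ B` of `systemMatrix A B C D`, for `A` nonsingular. -/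
noncomputable def transferFunction {ν α β : Type*} [Fintype ν] [DecidableEq ν]
    (A : Matrix ν ν (Polynomial F)) (B : Matrix ν β (Polynomial F))
    (C : Matrix α ν (Polynomial F)) (D : Matrix α β (Polynomial F)) : Matrix α β (RatFunc F) :=
  toRat D + toRat C * (toRat A)⁻¹ * toRat B

end RationalMatrix

open RationalMatrix

/-! Write a left null vector of the pencil as `[y₁ y₂ u w]`. Over `F(λ)`, both `z ↦ x = [u w]` and
`z ↦ u` map the left null-space of the pencil isomorphically onto those of `Rhat` and `R`. Such a
selection of coordinates respects minimal bases and their degrees as soon as a polynomial image of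
degree at most `d` forces a polynomial preimage of degree at most `d`; `IsDegreePreserving` records
this, and everything in the theorem follows from it formally. It is enough to recover `z` from `u`,
since `u` is part of `x`.

The recovery takes two divisions. Multiplying the null-space equations on the right by `N_Aᵀ` and
`N_Dᵀ` removes `K_A` and `K_D` and leaves `y₁ [A B] = [uC -uD]`. Full rank of `[A B]` at every
finite point makes `y₁` polynomial (`exists_toRatVec_of_vecMul`); full rank at infinity is the
hypothesis of the predictable degree property `natDegree_le_of_vecMul` and gives `deg y₁ ≤ d`. Next,
`y₂ K_A = u M_C - y₁ M_A` and `w K_D = -(y₁ M_B + u M_D)` have degree at most `d + 1`. A minimal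
basis with row degrees one has full rank at every finite point and a leading coefficient matrix of
full rank, so the same two tools make `y₂` and `w` polynomial of degree at most `d`. -/

namespace RationalMatrix

open Matrix Polynomial

/-! ### Polynomial vectors inside rational vectors, ranks and degrees -/

section

variable {F : Type*} [Field F] {α β κ ν ι : Type*}

/-- A polynomial vector regarded as a rational vector. -/
noncomputable def toRatVec (p : α → F[X]) : α → RatFunc F :=
  fun i => algebraMap F[X] (RatFunc F) (p i)

lemma toRatVec_injective : Function.Injective (toRatVec : (α → F[X]) → α → RatFunc F) :=
  fun _ _ h => funext fun i => IsFractionRing.injective F[X] (RatFunc F) (congrFun h i)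

lemma toRatVec_add (p q : α → F[X]) : toRatVec (p + q) = toRatVec p + toRatVec q := by
  ext i; simp [toRatVec]

lemma toRatVec_sub (p q : α → F[X]) : toRatVec (p - q) = toRatVec p - toRatVec q := by
  ext i; simp [toRatVec]

lemma toRatVec_neg (p : α → F[X]) : toRatVec (-p) = -toRatVec p := by
  ext i; simp [toRatVec]

lemma toRatVec_smul (d : F[X]) (p : α → F[X]) :
    toRatVec (d • p) = algebraMap F[X] (RatFunc F) d • toRatVec p := by
  ext i; simp [toRatVec]

lemma toRatVec_vecMul [Fintype α] (p : α → F[X]) (G : Matrix α β F[X]) :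
    toRatVec (p ᵥ* G) = toRatVec p ᵥ* toRat G :=
  funext fun i => (algebraMap F[X] (RatFunc F)).map_vecMul G p i

lemma toRat_row (Z : Matrix κ α F[X]) : (toRat Z).row = fun i => toRatVec (Z i) := rfl

lemma toRat_mul [Fintype α] (G : Matrix κ α F[X]) (H : Matrix α β F[X]) :
    toRat (G * H) = toRat G * toRat H := Matrix.map_mul

lemma toRat_det_ne_zero [Fintype α] [DecidableEq α] {A : Matrix α α F[X]} (hA : A.det ≠ 0) :
    (toRat A).det ≠ 0 := by
  have h : (toRat A).det = algebraMap F[X] (RatFunc F) A.det :=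
    ((algebraMap F[X] (RatFunc F)).map_det A).symm
  rw [h]
  exact (map_ne_zero_iff _ (IsFractionRing.injective F[X] (RatFunc F))).2 hA

lemma eq_zero_of_vecMul_toRat_eq_zero [Fintype α] [DecidableEq α] {A : Matrix α α F[X]}
    (hA : A.det ≠ 0) {v : α → RatFunc F} (h : v ᵥ* toRat A = 0) : v = 0 := by
  by_contra hv
  exact toRat_det_ne_zero hA (Matrix.exists_vecMul_eq_zero_iff.1 ⟨v, hv, h⟩)

lemma eq_zero_of_vecMul_eq_zero_of_rank [Fintype α] [Fintype β] {K : Type*} [Field K]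
    {G : Matrix α β K} (hG : G.rank = Fintype.card α) {c : α → K} (h : c ᵥ* G = 0) : c = 0 := by
  have hli : LinearIndependent K G.row := by
    rw [linearIndependent_iff_card_eq_finrank_span, ← hG, rank_eq_finrank_span_row]
    rfl
  exact Matrix.vecMul_injective_iff.2 hli (by simpa using h)

lemma natDegree_le_rowDegree [Fintype β] (G : Matrix α β F[X]) (i : α) (j : β) :
    (G i j).natDegree ≤ rowDegree G i :=
  Finset.le_sup (f := fun j => (G i j).natDegree) (Finset.mem_univ j)

lemma rowDegree_le_iff [Fintype β] {G : Matrix α β F[X]} {i : α} {d : ℕ} :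
    rowDegree G i ≤ d ↔ ∀ j, (G i j).natDegree ≤ d := by
  simp [rowDegree, Finset.sup_le_iff]

lemma natDegree_le_matDegree [Fintype α] [Fintype β] (G : Matrix α β F[X]) (i : α) (j : β) :
    (G i j).natDegree ≤ matDegree G :=
  (natDegree_le_rowDegree G i j).trans (Finset.le_sup (f := rowDegree G) (Finset.mem_univ i))

/-! ### Polynomial solutions of linear equations -/

/-- Induction on `deg d`: at a root `x` of `d` the vector `r(x)` is killed by `G(x)`, hence zero, so
`X - x` cancels from both sides. Algebraic closedness supplies the root. -/
lemma dvd_of_vecMul_eq_smul [IsAlgClosed F] [Fintype α] {G : Matrix α β F[X]}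
    (hG : ∀ x : F, ∀ c : α → F, c ᵥ* evalAt x G = 0 → c = 0) :
    ∀ (k : ℕ) (d : F[X]), d.natDegree = k → d ≠ 0 → ∀ (r : α → F[X]) (q : β → F[X]),
      r ᵥ* G = d • q → ∃ p : α → F[X], r = d • p := by
  intro k
  induction k with
  | zero =>
    intro d hd hd0 r q _
    obtain ⟨c, rfl⟩ := Polynomial.natDegree_eq_zero.1 hd
    have hc : c ≠ 0 := fun h => hd0 (by simp [h])
    exact ⟨C c⁻¹ • r, by rw [smul_smul, ← C_mul, mul_inv_cancel₀ hc]; simp⟩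
  | succ k ih =>
    intro d hd hd0 r q h
    obtain ⟨x, hx⟩ := IsAlgClosed.exists_root d (by
      intro h0
      have := natDegree_eq_zero_iff_degree_le_zero.2 h0.le
      omega)
    obtain ⟨d', rfl⟩ := dvd_iff_isRoot.2 hx
    have hX : (X - C x : F[X]) ≠ 0 := X_sub_C_ne_zero x
    have hd'0 : d' ≠ 0 := right_ne_zero_of_mul hd0
    have hr : (fun i => (r i).eval x) = 0 := by
      apply hG x
      ext j
      have := congrArg (Polynomial.eval x) (congrFun h j)
      simpa [Matrix.vecMul, dotProduct, eval_finsetSum, evalAt] using this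
    choose r' hr' using fun i => dvd_iff_isRoot.2 (congrFun hr i)
    have hr'' : r = (X - C x) • r' := funext hr'
    have h' : r' ᵥ* G = d' • q := by
      rw [hr'', Matrix.smul_vecMul, mul_smul] at h
      exact smul_right_injective _ hX h
    obtain ⟨p, hp⟩ := ih d' (by
      rw [natDegree_mul hX hd'0, natDegree_X_sub_C] at hd; omega) hd'0 r' q h'
    exact ⟨p, by rw [hr'', hp, mul_smul]⟩

/-- If `G(x)` has independent rows for all `x`, then `v` is polynomial once `v G` is. -/
lemma exists_toRatVec_of_vecMul [IsAlgClosed F] [Fintype α] {G : Matrix α β F[X]}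
    (hG : ∀ x : F, ∀ c : α → F, c ᵥ* evalAt x G = 0 → c = 0) {v : α → RatFunc F}
    {q : β → F[X]} (h : v ᵥ* toRat G = toRatVec q) : ∃ p : α → F[X], v = toRatVec p := by
  -- A common denominator `d` of `v`; it must divide the polynomial vector `r = d • v`.
  obtain ⟨⟨d, hd⟩, hb⟩ :=
    IsLocalization.exist_integer_multiples_of_finite (nonZeroDivisors F[X]) v
  have hd0 : d ≠ 0 := nonZeroDivisors.ne_zero hd
  have hd1 : algebraMap F[X] (RatFunc F) d ≠ 0 :=
    (map_ne_zero_iff _ (IsFractionRing.injective F[X] (RatFunc F))).2 hd0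
  choose r hr using hb
  have hr' : toRatVec r = algebraMap F[X] (RatFunc F) d • v := by
    ext i
    simpa [toRatVec, Algebra.smul_def] using hr i
  obtain ⟨p, rfl⟩ := dvd_of_vecMul_eq_smul hG _ d rfl hd0 r q (by
    apply toRatVec_injective
    rw [toRatVec_vecMul, hr', Matrix.smul_vecMul, h, toRatVec_smul])
  refine ⟨p, ?_⟩
  rw [toRatVec_smul] at hr'
  exact (smul_right_injective _ hd1 hr').symm

/-- The predictable degree property: if the coefficients of `λ ^ g j` in the columns `j` of `G`
form a matrix with independent rows, then `deg (p G) j ≤ d + g j` for all `j` gives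
`deg p ≤ d`. -/
lemma natDegree_le_of_vecMul [Fintype α] {G : Matrix α β F[X]} {g : β → ℕ}
    (hdeg : ∀ i j, (G i j).natDegree ≤ g j)
    (hG : ∀ c : α → F, (c ᵥ* Matrix.of fun i j => (G i j).coeff (g j)) = 0 → c = 0)
    {p : α → F[X]} {d : ℕ} (h : ∀ j, ((p ᵥ* G) j).natDegree ≤ d + g j) (i : α) :
    (p i).natDegree ≤ d := by
  by_contra! hi
  set e := Finset.univ.sup fun i => (p i).natDegree with he
  have hle : ∀ i, (p i).natDegree ≤ e := fun i =>
    Finset.le_sup (f := fun i => (p i).natDegree) (Finset.mem_univ i)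
  have hde : d < e := hi.trans_le (hle i)
  -- Were the top degree `e` of `p` larger than `d`, the coefficient of `λ ^ (e + g j)` in column
  -- `j` would vanish, giving a relation among the independent rows.
  have hc : (fun i => (p i).coeff e) = 0 := by
    apply hG
    ext j
    have h0 : ((p ᵥ* G) j).coeff (e + g j) = 0 :=
      coeff_eq_zero_of_natDegree_lt ((h j).trans_lt (by omega))
    rw [Matrix.vecMul, dotProduct, finsetSum_coeff] at h0
    rw [Matrix.vecMul, dotProduct, Pi.zero_apply, ← h0]
    exact Finset.sum_congr rfl fun i _ =>
      (coeff_mul_add_eq_of_natDegree_le (hle i) (hdeg i j)).symm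
  obtain ⟨k, -, hk⟩ := Finset.exists_mem_eq_sup Finset.univ ⟨i, Finset.mem_univ i⟩
    fun i => (p i).natDegree
  have hk0 := congrFun hc k
  rw [Pi.zero_apply, he, hk] at hk0
  have : p k = 0 := leadingCoeff_eq_zero.1 hk0
  rw [← he, this, natDegree_zero] at hk
  omega

/-! ### Minimal bases -/

/-- In a minimal basis no row that occurs in a combination divisible by `d` can be replaced by a
quotient of lower degree. -/
lemma IsMinimalBasis.rowDegree_le_of_vecMul [Fintype κ] [Fintype ι] {K : Matrix κ ι F[X]}
    (hK : IsMinimalBasis K) {c : κ → F} {d : F[X]} (hd : d ≠ 0) {s : ι → F[X]}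
    (h : (fun i => C (c i)) ᵥ* K = d • s) {i : κ} (hi : c i ≠ 0) {e : ℕ}
    (he : ∀ j, (s j).natDegree ≤ e) : rowDegree K i ≤ e := by
  classical
  set a := algebraMap F[X] (RatFunc F) with ha
  have hinj : Function.Injective a := IsFractionRing.injective F[X] (RatFunc F)
  have had : a d ≠ 0 := (map_ne_zero_iff _ hinj).2 hd
  have hac : a (C (c i)) ≠ 0 := (map_ne_zero_iff _ hinj).2 (C_ne_zero.2 hi)
  have hrat : ∑ k, a (C (c k)) • toRatVec (K k) = a d • toRatVec s := by
    rw [← toRatVec_smul, ← h]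
    ext j
    simp [toRatVec, Matrix.vecMul, dotProduct, ha]
  -- Exchange: `c i` and `d` are invertible in `F(λ)`, so replacing row `i` by `s` keeps the span,
  -- and by minimality the sum of degrees cannot drop.
  set Y := K.updateRow i s with hY
  have hYi : toRatVec (Y i) = toRatVec s := by simp [hY]
  have hYk : ∀ k, k ≠ i → toRatVec (Y k) = toRatVec (K k) := fun k hk => by
    simp [hY, Matrix.updateRow_ne hk]
  have hspan : Submodule.span (RatFunc F) (Set.range (toRat Y).row) =
      Submodule.span (RatFunc F) (Set.range (toRat K).row) := by
    rw [toRat_row, toRat_row]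
    apply le_antisymm
    · rw [Submodule.span_le]
      rintro _ ⟨k, rfl⟩
      rcases eq_or_ne k i with rfl | hk
      · have hs : toRatVec s = (a d)⁻¹ • ∑ l, a (C (c l)) • toRatVec (K l) := by
          rw [hrat, inv_smul_smul₀ had]
        simp only [SetLike.mem_coe, hYi]
        rw [hs]
        exact Submodule.smul_mem _ _ (Submodule.sum_mem _ fun l _ =>
          Submodule.smul_mem _ _ (Submodule.subset_span ⟨l, rfl⟩))
      · simp only [SetLike.mem_coe, hYk k hk]
        exact Submodule.subset_span ⟨k, rfl⟩
    · rw [Submodule.span_le]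
      rintro _ ⟨k, rfl⟩
      rcases eq_or_ne k i with rfl | hk
      · have hs : toRatVec (K k) = (a (C (c k)))⁻¹ • (a d • toRatVec (Y k) -
            ∑ l ∈ Finset.univ.erase k, a (C (c l)) • toRatVec (Y l)) := by
          have hsum : ∑ l ∈ Finset.univ.erase k, a (C (c l)) • toRatVec (Y l) =
              ∑ l ∈ Finset.univ.erase k, a (C (c l)) • toRatVec (K l) :=
            Finset.sum_congr rfl fun l hl => by rw [hYk l (Finset.ne_of_mem_erase hl)]
          rw [eq_inv_smul_iff₀ hac, hYi, ← hrat, hsum,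
            ← Finset.add_sum_erase Finset.univ _ (Finset.mem_univ k), add_sub_cancel_right]
        simp only [SetLike.mem_coe]
        rw [hs]
        exact Submodule.smul_mem _ _ (Submodule.sub_mem _
          (Submodule.smul_mem _ _ (Submodule.subset_span ⟨k, rfl⟩))
          (Submodule.sum_mem _ fun l _ =>
            Submodule.smul_mem _ _ (Submodule.subset_span ⟨l, rfl⟩)))
      · simp only [SetLike.mem_coe, ← hYk k hk]
        exact Submodule.subset_span ⟨k, rfl⟩
  have hli : LinearIndependent (RatFunc F) (toRat Y).row := by
    rw [linearIndependent_iff_card_eq_finrank_span, Set.finrank, hspan]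
    exact linearIndependent_iff_card_eq_finrank_span.1 hK.1.1
  have hmin := hK.2 Y ⟨hli, hspan⟩
  rw [← Finset.add_sum_erase _ (rowDegree K) (Finset.mem_univ i),
    ← Finset.add_sum_erase _ (rowDegree Y) (Finset.mem_univ i)] at hmin
  have hrest : ∑ k ∈ Finset.univ.erase i, rowDegree K k =
      ∑ k ∈ Finset.univ.erase i, rowDegree Y k :=
    Finset.sum_congr rfl fun k hk => by
      simp [rowDegree, hY, Matrix.updateRow_ne (Finset.ne_of_mem_erase hk)]
  have hYdeg : rowDegree Y i ≤ e := rowDegree_le_iff.2 fun j => by simpa [hY] using he j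
  omega

/-- If `c K` vanished at `x`, dividing it by `X - x` would give a constant vector that could replace
a row of degree one, against minimality. -/
lemma IsMinimalBasis.eq_zero_of_vecMul_evalAt [Fintype κ] [Fintype ι] {K : Matrix κ ι F[X]}
    (hK : IsMinimalBasis K) (hdeg : ∀ i, rowDegree K i = 1) (x : F) (c : κ → F)
    (h : c ᵥ* evalAt x K = 0) : c = 0 := by
  by_contra hc
  obtain ⟨i, hi⟩ := Function.ne_iff.1 hc
  have hroot : ∀ j, X - C x ∣ ((fun i => C (c i)) ᵥ* K) j := fun j => by
    rw [dvd_iff_isRoot]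
    have := congrFun h j
    simpa [Matrix.vecMul, dotProduct, eval_finsetSum, evalAt] using this
  choose s hs using hroot
  have hle : ∀ j, (((fun i => C (c i)) ᵥ* K) j).natDegree ≤ 1 := fun j =>
    natDegree_sum_le_of_forall_le _ _ fun k _ =>
      (natDegree_C_mul_le _ _).trans ((natDegree_le_rowDegree K k j).trans (hdeg k).le)
  have hs0 : ∀ j, (s j).natDegree ≤ 0 := fun j => by
    rcases eq_or_ne (s j) 0 with h0 | h0
    · simp [h0]
    · have := hle j
      rw [hs, natDegree_mul (X_sub_C_ne_zero x) h0, natDegree_X_sub_C] at this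
      omega
  have := hK.rowDegree_le_of_vecMul (X_sub_C_ne_zero x) (funext hs) hi hs0
  rw [hdeg] at this
  omega

/-- If `c` cancelled the coefficients of `λ`, then `c K` would itself be constant and could replace
a row of degree one; here the divisor is `1`. -/
lemma IsMinimalBasis.eq_zero_of_vecMul_coeff [Fintype κ] [Fintype ι] {K : Matrix κ ι F[X]}
    (hK : IsMinimalBasis K) (hdeg : ∀ i, rowDegree K i = 1) (c : κ → F)
    (h : (c ᵥ* Matrix.of fun i j => (K i j).coeff 1) = 0) : c = 0 := by
  by_contra hc
  obtain ⟨i, hi⟩ := Function.ne_iff.1 hc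
  have hs0 : ∀ j, (((fun i => C (c i)) ᵥ* K) j).natDegree ≤ 0 := fun j => by
    rw [natDegree_le_iff_coeff_eq_zero]
    intro k hk
    rcases eq_or_ne k 1 with rfl | hk1
    · have := congrFun h j
      simpa [Matrix.vecMul, dotProduct, finsetSum_coeff] using this
    · rw [Matrix.vecMul, dotProduct, finsetSum_coeff]
      refine Finset.sum_eq_zero fun l _ => ?_
      rw [coeff_C_mul, coeff_eq_zero_of_natDegree_lt, mul_zero]
      exact ((natDegree_le_rowDegree K l j).trans (hdeg l).le).trans_lt (by omega)
  have := hK.rowDegree_le_of_vecMul one_ne_zero (one_smul _ _).symm hi hs0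
  rw [hdeg] at this
  omega

lemma IsMinimalBasis.eq_zero_of_vecMul_toRat [Fintype κ] [Fintype ι] {K : Matrix κ ι F[X]}
    (hK : IsMinimalBasis K) {v : κ → RatFunc F} (h : v ᵥ* toRat K = 0) : v = 0 :=
  Matrix.vecMul_injective_iff.2 hK.1.1 (by simpa using h)

/-- For a minimal basis `K` of row degrees one, `y K` polynomial of degree at most `d + 1` forces
`y` to be polynomial of degree at most `d`. -/
lemma IsMinimalBasis.exists_toRatVec_of_vecMul [IsAlgClosed F] [Fintype κ] [Fintype ι]
    {K : Matrix κ ι F[X]} (hK : IsMinimalBasis K) (hdeg : ∀ i, rowDegree K i = 1)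
    {v : κ → RatFunc F} {q : ι → F[X]} (h : v ᵥ* toRat K = toRatVec q) :
    ∃ p : κ → F[X], v = toRatVec p ∧
      ∀ d, (∀ j, (q j).natDegree ≤ d + 1) → ∀ i, (p i).natDegree ≤ d := by
  obtain ⟨p, rfl⟩ :=
    RationalMatrix.exists_toRatVec_of_vecMul (hK.eq_zero_of_vecMul_evalAt hdeg) h
  refine ⟨p, rfl, fun d hq => ?_⟩
  rw [← toRatVec_vecMul] at h
  refine natDegree_le_of_vecMul (g := fun _ => 1)
    (fun i j => (natDegree_le_rowDegree K i j).trans (hdeg i).le)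
    (hK.eq_zero_of_vecMul_coeff hdeg) ?_
  rwa [toRatVec_injective h]

/-- The row space of `K` is the left null-space of `Nᵀ` when `K` and `N` are dual. -/
lemma IsDualMinimalBasis.exists_vecMul_eq [Fintype κ] [Fintype ν] [Fintype ι]
    {K : Matrix κ ι F[X]} {N : Matrix ν ι F[X]} (h : IsDualMinimalBasis K N)
    {v : ι → RatFunc F} (hv : v ᵥ* (toRat N)ᵀ = 0) : ∃ y, y ᵥ* toRat K = v := by
  have hKN : toRat K * (toRat N)ᵀ = 0 := by
    have : toRat (K * Nᵀ) = 0 := by rw [h.mul_transpose]; ext; simp [toRat]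
    rwa [toRat_mul] at this
  -- Duality gives one inclusion; equality follows by dimension, both sides having dimension `card ι
  -- - card ν = card κ`.
  have hle : LinearMap.range (toRat K).vecMulLinear ≤ LinearMap.ker (toRat N)ᵀ.vecMulLinear := by
    rintro _ ⟨y, rfl⟩
    rw [LinearMap.mem_ker, Matrix.vecMulLinear_apply, Matrix.vecMulLinear_apply,
      Matrix.vecMul_vecMul, hKN, Matrix.vecMul_zero]
  have hK : Module.finrank (RatFunc F) (LinearMap.range (toRat K).vecMulLinear) =
      Fintype.card κ := by
    rw [LinearMap.finrank_range_of_inj (Matrix.vecMul_injective_iff.2 h.minimal_left.1.1),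
      Module.finrank_fintype_fun_eq_card]
  have hN : Module.finrank (RatFunc F) (LinearMap.range (toRat N)ᵀ.vecMulLinear) =
      Fintype.card ν := by
    have : (toRat N)ᵀ.vecMulLinear = (toRat N).mulVecLin :=
      LinearMap.ext fun x => Matrix.vecMul_transpose _ _
    rw [← h.minimal_right.1.1.rank_matrix, Matrix.rank, this]
  have hsum := LinearMap.finrank_range_add_finrank_ker (toRat N)ᵀ.vecMulLinear
  rw [hN, Module.finrank_fintype_fun_eq_card, ← h.card_add_card] at hsum
  have heq := Submodule.eq_of_le_of_finrank_eq hle (by omega)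
  have : v ∈ LinearMap.range (toRat K).vecMulLinear := by
    rw [heq]; exact hv
  exact this


/-! ### Degree-preserving selections of coordinates -/

/-- Selecting the coordinates `f` maps the rational space `V` isomorphically onto `W`, and a vector
of `V` whose selected coordinates are polynomials is polynomial, of no larger degree. -/
structure IsDegreePreserving (V : Submodule (RatFunc F) (α → RatFunc F))
    (W : Submodule (RatFunc F) (β → RatFunc F)) (f : β → α) : Prop where
  map_eq : V.map (LinearMap.funLeft (RatFunc F) (RatFunc F) f) = W
  eq_zero : ∀ v ∈ V, v ∘ f = 0 → v = 0
  exists_toRatVec : ∀ v ∈ V, ∀ q : β → F[X], v ∘ f = toRatVec q →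
    ∃ p : α → F[X], v = toRatVec p ∧
      ∀ d, (∀ j, (q j).natDegree ≤ d) → ∀ i, (p i).natDegree ≤ d

namespace IsDegreePreserving

variable {V : Submodule (RatFunc F) (α → RatFunc F)} {W : Submodule (RatFunc F) (β → RatFunc F)}
  {f : β → α}

lemma disjoint_ker (h : IsDegreePreserving V W f) :
    Disjoint V (LinearMap.ker (LinearMap.funLeft (RatFunc F) (RatFunc F) f)) :=
  LinearMap.disjoint_ker.2 h.eq_zero

lemma isPolynomialBasis_submatrix (h : IsDegreePreserving V W f) {Z : Matrix κ α F[X]}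
    (hZ : IsPolynomialBasis V Z) : IsPolynomialBasis W (Z.submatrix id f) := by
  refine ⟨hZ.1.map (f := LinearMap.funLeft (RatFunc F) (RatFunc F) f) ?_, ?_⟩
  · rw [hZ.2]; exact h.disjoint_ker
  · rw [← h.map_eq, ← hZ.2, Submodule.map_span, ← Set.range_comp]
    rfl

/-- Each row of `Y` has a preimage in `V`, polynomial because `Y` is. Independence is inherited from
the images, and spanning follows from injectivity on `V`. -/
lemma exists_isPolynomialBasis (h : IsDegreePreserving V W f) {Y : Matrix κ β F[X]}
    (hY : IsPolynomialBasis W Y) :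
    ∃ Z : Matrix κ α F[X], IsPolynomialBasis V Z ∧ Z.submatrix id f = Y := by
  have hmem : ∀ i, ∃ p : α → F[X], toRatVec p ∈ V ∧ p ∘ f = Y i := fun i => by
    have hi : (toRat Y).row i ∈ W := hY.2 ▸ Submodule.subset_span ⟨i, rfl⟩
    rw [← h.map_eq] at hi
    obtain ⟨v, hv, hvi⟩ := hi
    obtain ⟨p, rfl, -⟩ := h.exists_toRatVec v hv (Y i) hvi
    exact ⟨p, hv, toRatVec_injective hvi⟩
  choose Z hZV hZY using hmem
  have hsub : Matrix.submatrix (of Z) id f = Y := funext hZY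
  have hrow : (LinearMap.funLeft (RatFunc F) (RatFunc F) f) ∘ (toRat (of Z)).row =
      (toRat Y).row := by
    rw [← hsub]; rfl
  have hle : Submodule.span (RatFunc F) (Set.range (toRat (of Z)).row) ≤ V := by
    rw [Submodule.span_le]
    rintro _ ⟨i, rfl⟩
    exact hZV i
  refine ⟨of Z, ⟨.of_comp (LinearMap.funLeft (RatFunc F) (RatFunc F) f) ?_, ?_⟩, hsub⟩
  · rw [hrow]; exact hY.1
  · refine le_antisymm hle fun v hv => ?_
    have hvW : LinearMap.funLeft (RatFunc F) (RatFunc F) f v ∈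
        (Submodule.span (RatFunc F) (Set.range (toRat (of Z)).row)).map
          (LinearMap.funLeft (RatFunc F) (RatFunc F) f) := by
      rw [Submodule.map_span, ← Set.range_comp, hrow, hY.2, ← h.map_eq]
      exact ⟨v, hv, rfl⟩
    obtain ⟨w, hw, hwv⟩ := hvW
    have : w = v := sub_eq_zero.1 <| h.eq_zero _ (V.sub_mem (hle hw) hv) <|
      (map_sub (LinearMap.funLeft (RatFunc F) (RatFunc F) f) w v).trans (sub_eq_zero.2 hwv)
    exact this ▸ hw

variable [Fintype α] [Fintype β]

/-- Dropping coordinates cannot raise a degree; the lifting bound, taken with `d` the degree of the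
selected row, shows that it does not lower it. -/
lemma rowDegree_submatrix (h : IsDegreePreserving V W f) {Z : Matrix κ α F[X]}
    (hZ : IsPolynomialBasis V Z) (i : κ) : rowDegree (Z.submatrix id f) i = rowDegree Z i := by
  apply le_antisymm
  · exact rowDegree_le_iff.2 fun j => natDegree_le_rowDegree Z i (f j)
  · obtain ⟨p, hp, hdeg⟩ := h.exists_toRatVec (toRatVec (Z i))
      (hZ.2 ▸ Submodule.subset_span ⟨i, rfl⟩) (Z.submatrix id f i) rfl
    rw [← toRatVec_injective hp] at hdeg
    exact rowDegree_le_iff.2 (hdeg _ fun j => natDegree_le_rowDegree (Z.submatrix id f) i j)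

variable [Fintype κ]

/-- Any competing basis of `W` lifts to a competitor of `Z` with the same row degrees. -/
lemma isMinimalBasisOf_submatrix (h : IsDegreePreserving V W f) {Z : Matrix κ α F[X]}
    (hZ : IsMinimalBasisOf V Z) : IsMinimalBasisOf W (Z.submatrix id f) := by
  refine ⟨h.isPolynomialBasis_submatrix hZ.1, fun Y hY => ?_⟩
  obtain ⟨X, hX, rfl⟩ := h.exists_isPolynomialBasis hY
  simpa only [h.rowDegree_submatrix hZ.1, h.rowDegree_submatrix hX] using hZ.2 X hX

lemma exists_isMinimalBasisOf (h : IsDegreePreserving V W f) {Y : Matrix κ β F[X]}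
    (hY : IsMinimalBasisOf W Y) :
    ∃ Z : Matrix κ α F[X], IsMinimalBasisOf V Z ∧ Z.submatrix id f = Y := by
  obtain ⟨Z, hZ, rfl⟩ := h.exists_isPolynomialBasis hY.1
  refine ⟨Z, ⟨hZ, fun X hX => ?_⟩, rfl⟩
  simpa only [h.rowDegree_submatrix hZ, h.rowDegree_submatrix hX] using
    hY.2 _ (h.isPolynomialBasis_submatrix hX)

/-- The minimal bases of the two spaces correspond with equal row degrees. Both directions are
needed, since minimal indices constrain every minimal basis. -/
lemma isMinimalIndices_iff (h : IsDegreePreserving V W f) {t : ℕ} (η : Fin t → ℕ) :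
    IsMinimalIndices V η ↔ IsMinimalIndices W η := by
  refine and_congr_right fun _ => and_congr ?_ ?_
  · constructor
    · rintro ⟨Z, hZ⟩
      exact ⟨_, h.isMinimalBasisOf_submatrix hZ⟩
    · rintro ⟨Y, hY⟩
      obtain ⟨Z, hZ, -⟩ := h.exists_isMinimalBasisOf hY
      exact ⟨Z, hZ⟩
  · constructor
    · intro H Y hY
      obtain ⟨Z, hZ, rfl⟩ := h.exists_isMinimalBasisOf hY
      simpa only [h.rowDegree_submatrix hZ.1] using H Z hZ
    · intro H Z hZ
      simpa only [h.rowDegree_submatrix hZ.1] using H _ (h.isMinimalBasisOf_submatrix hZ)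

end IsDegreePreserving

/-! ### Polynomial system matrices -/

lemma mem_leftNullspace [Fintype α] {G : Matrix α β (RatFunc F)} {v : α → RatFunc F} :
    v ∈ leftNullspace G ↔ v ᵥ* G = 0 := Iff.rfl

lemma mem_leftNullspace_systemMatrix [Fintype α] [Fintype ν] {A : Matrix ν ν F[X]}
    {B : Matrix ν β F[X]} {C : Matrix α ν F[X]} {D : Matrix α β F[X]}
    {z : ν ⊕ α → RatFunc F} :
    z ∈ leftNullspace (toRat (systemMatrix A B C D)) ↔
      (z ∘ Sum.inl) ᵥ* toRat A = (z ∘ Sum.inr) ᵥ* toRat C ∧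
      (z ∘ Sum.inl) ᵥ* toRat B + (z ∘ Sum.inr) ᵥ* toRat D = 0 := by
  have hmat : toRat (systemMatrix A B C D) =
      fromBlocks (toRat A) (toRat B) (-toRat C) (toRat D) := by
    ext (i | i) (j | j) <;> simp [toRat, systemMatrix]
  rw [mem_leftNullspace, hmat, Matrix.vecMul_fromBlocks, Matrix.vecMul_neg, ← sub_eq_add_neg,
    ← sub_eq_zero (b := (z ∘ Sum.inr) ᵥ* toRat C), ← Sum.elim_zero_zero, Sum.elim_eq_iff]

lemma mem_leftNullspace_transferFunction [Fintype α] [Fintype ν] [DecidableEq ν]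
    {A : Matrix ν ν F[X]} {B : Matrix ν β F[X]} {C : Matrix α ν F[X]} {D : Matrix α β F[X]}
    {x : α → RatFunc F} :
    x ∈ leftNullspace (transferFunction A B C D) ↔
      (x ᵥ* toRat C ᵥ* (toRat A)⁻¹) ᵥ* toRat B + x ᵥ* toRat D = 0 := by
  rw [mem_leftNullspace, transferFunction, Matrix.vecMul_add, ← Matrix.vecMul_vecMul,
    ← Matrix.vecMul_vecMul, add_comm]

/-- Block elimination: invertibility of `A` over `F(λ)` solves for the state part, and substituting
it leaves the transfer function. -/
lemma mem_leftNullspace_systemMatrix_iff [Fintype α] [Fintype ν] [DecidableEq ν]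
    {A : Matrix ν ν F[X]} (hA : A.det ≠ 0) {B : Matrix ν β F[X]} {C : Matrix α ν F[X]}
    {D : Matrix α β F[X]} {z : ν ⊕ α → RatFunc F} :
    z ∈ leftNullspace (toRat (systemMatrix A B C D)) ↔
      z ∘ Sum.inl = (z ∘ Sum.inr) ᵥ* toRat C ᵥ* (toRat A)⁻¹ ∧
        z ∘ Sum.inr ∈ leftNullspace (transferFunction A B C D) := by
  have hU : IsUnit (toRat A).det := isUnit_iff_ne_zero.2 (toRat_det_ne_zero hA)
  have key : (z ∘ Sum.inl) ᵥ* toRat A = (z ∘ Sum.inr) ᵥ* toRat C ↔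
      z ∘ Sum.inl = (z ∘ Sum.inr) ᵥ* toRat C ᵥ* (toRat A)⁻¹ := by
    constructor
    · intro h
      rw [← h, Matrix.vecMul_vecMul, Matrix.mul_nonsing_inv _ hU, Matrix.vecMul_one]
    · intro h
      rw [h, Matrix.vecMul_vecMul _ (toRat A)⁻¹, Matrix.nonsing_inv_mul _ hU, Matrix.vecMul_one]
  rw [mem_leftNullspace_systemMatrix, mem_leftNullspace_transferFunction, key]
  exact and_congr_right fun h => by rw [h]

lemma map_funLeft_leftNullspace_systemMatrix [Fintype α] [Fintype ν] [DecidableEq ν]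
    {A : Matrix ν ν F[X]} (hA : A.det ≠ 0) (B : Matrix ν β F[X]) (C : Matrix α ν F[X])
    (D : Matrix α β F[X]) :
    (leftNullspace (toRat (systemMatrix A B C D))).map
      (LinearMap.funLeft (RatFunc F) (RatFunc F) Sum.inr) =
        leftNullspace (transferFunction A B C D) := by
  ext x
  constructor
  · rintro ⟨z, hz, rfl⟩
    exact ((mem_leftNullspace_systemMatrix_iff hA).1 hz).2
  · intro hx
    exact ⟨Sum.elim (x ᵥ* toRat C ᵥ* (toRat A)⁻¹) x,
      (mem_leftNullspace_systemMatrix_iff hA).2 ⟨rfl, hx⟩, rfl⟩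

lemma eq_zero_of_mem_leftNullspace_systemMatrix [Fintype α] [Fintype ν] [DecidableEq ν]
    {A : Matrix ν ν F[X]} (hA : A.det ≠ 0) {B : Matrix ν β F[X]} {C : Matrix α ν F[X]}
    {D : Matrix α β F[X]} {z : ν ⊕ α → RatFunc F}
    (hz : z ∈ leftNullspace (toRat (systemMatrix A B C D))) (h : z ∘ Sum.inr = 0) : z = 0 := by
  have h1 := ((mem_leftNullspace_systemMatrix_iff hA).1 hz).1
  rw [h, Matrix.zero_vecMul, Matrix.zero_vecMul] at h1
  ext (i | i)
  · exact congrFun h1 i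
  · exact congrFun h i

lemma natDegree_vecMul_le [Fintype α] {p : α → F[X]} {G : Matrix α β F[X]} {d e : ℕ} {j : β}
    (hp : ∀ i, (p i).natDegree ≤ d) (hG : ∀ i, (G i j).natDegree ≤ e) :
    ((p ᵥ* G) j).natDegree ≤ d + e :=
  natDegree_sum_le_of_forall_le _ _ fun i _ => natDegree_mul_le_of_le (hp i) (hG i)

/-- Source of the exponents `ρ + 1` in the reversals: a linear factor adds at most one to `deg N`.
-/
lemma IsPencil.natDegree_mul_transpose_le [Fintype ν] [Fintype ι] {M : Matrix α ι F[X]}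
    (hM : IsPencil M) (N : Matrix ν ι F[X]) (i : α) (j : ν) :
    ((M * Nᵀ) i j).natDegree ≤ matDegree N + 1 := by
  refine natDegree_sum_le_of_forall_le _ _ fun k _ => ?_
  rw [add_comm]
  exact natDegree_mul_le_of_le (hM i k) (natDegree_le_matDegree N j k)

/-- Under coprimeness of `A` and `B` at all finite points and at infinity, the state part of a
vector in the left null-space of a system matrix is polynomial, of no larger degree, when the
remaining part is. -/
lemma exists_toRatVec_of_mem_leftNullspace_systemMatrix [IsAlgClosed F] [Fintype α] [Fintype β]
    [Fintype ν] {A : Matrix ν ν F[X]} {B : Matrix ν β F[X]} {C : Matrix α ν F[X]}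
    {D : Matrix α β F[X]} {a b : ℕ}
    (hA : ∀ i j, (A i j).natDegree ≤ a) (hB : ∀ i j, (B i j).natDegree ≤ b)
    (hC : ∀ i j, (C i j).natDegree ≤ a) (hD : ∀ i j, (D i j).natDegree ≤ b)
    (hfin : ∀ x : F, (fromCols (evalAt x A) (evalAt x B)).rank = Fintype.card ν)
    (hinf : (fromCols (evalAt 0 (rev a A)) (evalAt 0 (rev b B))).rank = Fintype.card ν)
    {y : ν → RatFunc F} {q : α → F[X]}
    (h₁ : y ᵥ* toRat A = toRatVec q ᵥ* toRat C)
    (h₂ : y ᵥ* toRat B + toRatVec q ᵥ* toRat D = 0) :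
    ∃ p : ν → F[X], y = toRatVec p ∧
      ∀ d, (∀ j, (q j).natDegree ≤ d) → ∀ i, (p i).natDegree ≤ d := by
  -- Both null-space equations at once: `y [A B] = [qC -qD]`.
  have hvec : y ᵥ* toRat (fromCols A B) = toRatVec (Sum.elim (q ᵥ* C) (-(q ᵥ* D))) := by
    have hcols : toRat (fromCols A B) = fromCols (toRat A) (toRat B) := by
      ext i (j | j) <;> rfl
    rw [hcols, Matrix.vecMul_fromCols, h₁, eq_neg_of_add_eq_zero_left h₂, ← toRatVec_vecMul,
      ← toRatVec_vecMul, ← toRatVec_neg]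
    ext (j | j) <;> rfl
  obtain ⟨p, rfl⟩ := RationalMatrix.exists_toRatVec_of_vecMul (fun x c hc => by
    refine eq_zero_of_vecMul_eq_zero_of_rank (hfin x) ?_
    rw [← hc]
    congr 1
    ext i (j | j) <;> rfl) hvec
  refine ⟨p, rfl, fun d hq => ?_⟩
  rw [← toRatVec_vecMul] at hvec
  -- With bound `a` on the columns of `A` and `b` on those of `B`, the top coefficient matrix is the
  -- pair of reversals at `0`, so `hinf` is the rank condition required.
  refine natDegree_le_of_vecMul (G := fromCols A B) (g := Sum.elim (fun _ => a) fun _ => b) ?_ ?_ ?_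
  · rintro i (j | j)
    · exact hA i j
    · exact hB i j
  · intro c hc
    refine eq_zero_of_vecMul_eq_zero_of_rank hinf ?_
    rw [← hc]
    congr 1
    ext i (j | j) <;> simp [evalAt, rev, ← coeff_zero_eq_eval_zero, coeff_reflect]
  · rw [toRatVec_injective hvec]
    rintro (j | j)
    · exact natDegree_vecMul_le hq fun i => hC i j
    · simpa using natDegree_vecMul_le hq fun i => hD i j

/-! ### Block minimal bases linearizations -/

lemma toRat_transpose (G : Matrix α β F[X]) : toRat Gᵀ = (toRat G)ᵀ := rfl

lemma toRat_fromRows (G : Matrix α ι F[X]) (H : Matrix β ι F[X]) :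
    toRat (fromRows G H) = fromRows (toRat G) (toRat H) := fromRows_map _ _ _

lemma toRat_zero : toRat (0 : Matrix α β F[X]) = 0 := by
  ext; simp [toRat]

/-- For a left null vector `[v₁ v₂]`, multiplying by `Nᵀ` kills the `K` part, so `v₁ M Nᵀ = 0` and
`v₁ = 0`; then `v₂ K = 0` gives `v₂ = 0`. -/
lemma det_fromRows_ne_zero [Fintype κ] [Fintype ν] [DecidableEq κ] [DecidableEq ν]
    {M N : Matrix ν (ν ⊕ κ) F[X]} {K : Matrix κ (ν ⊕ κ) F[X]} (h : IsDualMinimalBasis K N)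
    (hdet : (M * Nᵀ).det ≠ 0) : Matrix.det (fromRows M K : Matrix (ν ⊕ κ) (ν ⊕ κ) F[X]) ≠ 0 := by
  intro h0
  have h0' : (toRat (fromRows M K : Matrix (ν ⊕ κ) (ν ⊕ κ) F[X])).det = 0 := by
    have := (algebraMap F[X] (RatFunc F)).map_det (fromRows M K : Matrix (ν ⊕ κ) (ν ⊕ κ) F[X])
    rw [h0, map_zero] at this
    exact this.symm
  obtain ⟨v, hv, hv0⟩ := Matrix.exists_vecMul_eq_zero_iff.2 h0'
  rw [toRat_fromRows, Matrix.vecMul_fromRows] at hv0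
  have hl : v ∘ Sum.inl = 0 := by
    apply eq_zero_of_vecMul_toRat_eq_zero hdet
    have := congrArg (· ᵥ* (toRat N)ᵀ) hv0
    simpa only [Matrix.add_vecMul, Matrix.vecMul_vecMul, ← toRat_transpose, ← toRat_mul,
      h.mul_transpose, toRat_zero, Matrix.vecMul_zero, add_zero, Matrix.zero_vecMul] using this
  have hr : v ∘ Sum.inr = 0 := by
    rw [hl, Matrix.zero_vecMul, zero_add] at hv0
    exact h.minimal_left.eq_zero_of_vecMul_toRat hv0
  apply hv
  ext (i | i)
  · exact congrFun hl i
  · exact congrFun hr i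

end

/-! ### Left null vectors of the block pencil -/

section

variable {F : Type*} [Field F] {α β κ ν ι μ o : Type*}

lemma mem_leftNullspace_blockSystemMatrix [Fintype α] [Fintype κ] [Fintype ν] [Fintype o]
    {MA : Matrix ν (ν ⊕ κ) F[X]} {KA : Matrix κ (ν ⊕ κ) F[X]} {MB : Matrix ν ι F[X]}
    {MC : Matrix α (ν ⊕ κ) F[X]} {MD : Matrix α ι F[X]} {KD : Matrix o ι F[X]}
    {z : (ν ⊕ κ) ⊕ (α ⊕ o) → RatFunc F} :
    z ∈ leftNullspace (toRat (systemMatrix (fromRows MA KA) (fromRows MB 0) (fromRows MC 0)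
        (fromRows MD KD))) ↔
      (z ∘ Sum.inl ∘ Sum.inl) ᵥ* toRat MA + (z ∘ Sum.inl ∘ Sum.inr) ᵥ* toRat KA =
          (z ∘ Sum.inr ∘ Sum.inl) ᵥ* toRat MC ∧
        (z ∘ Sum.inl ∘ Sum.inl) ᵥ* toRat MB + ((z ∘ Sum.inr ∘ Sum.inl) ᵥ* toRat MD +
          (z ∘ Sum.inr ∘ Sum.inr) ᵥ* toRat KD) = 0 := by
  rw [mem_leftNullspace_systemMatrix]
  simp only [toRat_fromRows, Matrix.vecMul_fromRows, toRat_zero, Matrix.vecMul_zero, add_zero,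
    Function.comp_assoc]

variable [Fintype α] [Fintype κ] [Fintype ν] [Fintype o] [Fintype ι]
  {MA NA : Matrix ν (ν ⊕ κ) F[X]} {KA : Matrix κ (ν ⊕ κ) F[X]} {MB : Matrix ν ι F[X]}
  {MC : Matrix α (ν ⊕ κ) F[X]} {MD : Matrix α ι F[X]} {KD : Matrix o ι F[X]}
  {ND : Matrix μ ι F[X]}

/-- The parts multiplying `M_A`, `M_B` and `M_C`, `M_D` of a vector in the left null-space of the
pencil form a vector in the left null-space of the system matrix that it linearizes. -/
lemma mem_leftNullspace_of_block (hKA : KA * NAᵀ = 0) (hKD : KD * NDᵀ = 0)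
    {z : (ν ⊕ κ) ⊕ (α ⊕ o) → RatFunc F}
    (hz : z ∈ leftNullspace (toRat (systemMatrix (fromRows MA KA) (fromRows MB 0) (fromRows MC 0)
        (fromRows MD KD)))) :
    Sum.elim (z ∘ Sum.inl ∘ Sum.inl) (z ∘ Sum.inr ∘ Sum.inl) ∈
      leftNullspace (toRat (systemMatrix (MA * NAᵀ) (MB * NDᵀ) (MC * NAᵀ) (MD * NDᵀ))) := by
  rw [mem_leftNullspace_blockSystemMatrix] at hz
  rw [mem_leftNullspace_systemMatrix, Sum.elim_comp_inl, Sum.elim_comp_inr]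
  have h1 := congrArg (· ᵥ* toRat NAᵀ) hz.1
  have h2 := congrArg (· ᵥ* toRat NDᵀ) hz.2
  simp only [Matrix.add_vecMul, Matrix.vecMul_vecMul, ← toRat_mul, hKA, hKD, toRat_zero,
    Matrix.vecMul_zero, add_zero, Matrix.zero_vecMul] at h1 h2
  exact ⟨h1, h2⟩

/-- The residuals left by the `M` blocks are annihilated by `N_Aᵀ` and `N_Dᵀ`, so by duality they
lie in the row spaces of `K_A` and `K_D`, which yields the missing blocks. -/
lemma exists_block_mem_leftNullspace [Fintype μ] (hA : IsDualMinimalBasis KA NA)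
    (hD : IsDualMinimalBasis KD ND)
    {z : ν ⊕ α → RatFunc F}
    (hz : z ∈ leftNullspace
      (toRat (systemMatrix (MA * NAᵀ) (MB * NDᵀ) (MC * NAᵀ) (MD * NDᵀ)))) :
    ∃ v ∈ leftNullspace (toRat (systemMatrix (fromRows MA KA) (fromRows MB 0) (fromRows MC 0)
        (fromRows MD KD))),
      (v : (ν ⊕ κ) ⊕ (α ⊕ o) → RatFunc F) ∘ Sum.inr ∘ Sum.inl = z ∘ Sum.inr := by
  obtain ⟨h1, h2⟩ := mem_leftNullspace_systemMatrix.1 hz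
  obtain ⟨y, hy⟩ := hA.exists_vecMul_eq
    (v := (z ∘ Sum.inr) ᵥ* toRat MC - (z ∘ Sum.inl) ᵥ* toRat MA) (by
      rw [Matrix.sub_vecMul, ← toRat_transpose, Matrix.vecMul_vecMul, Matrix.vecMul_vecMul,
        ← toRat_mul, ← toRat_mul, h1, sub_self])
  obtain ⟨w, hw⟩ := hD.exists_vecMul_eq
    (v := -((z ∘ Sum.inl) ᵥ* toRat MB + (z ∘ Sum.inr) ᵥ* toRat MD)) (by
      rw [Matrix.neg_vecMul, Matrix.add_vecMul, ← toRat_transpose, Matrix.vecMul_vecMul,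
        Matrix.vecMul_vecMul, ← toRat_mul, ← toRat_mul, h2, neg_zero])
  refine ⟨Sum.elim (Sum.elim (z ∘ Sum.inl) y) (Sum.elim (z ∘ Sum.inr) w),
    mem_leftNullspace_blockSystemMatrix.2 ⟨?_, ?_⟩, rfl⟩
  · change (z ∘ Sum.inl) ᵥ* toRat MA + y ᵥ* toRat KA = (z ∘ Sum.inr) ᵥ* toRat MC
    rw [hy, add_sub_cancel]
  · change (z ∘ Sum.inl) ᵥ* toRat MB + ((z ∘ Sum.inr) ᵥ* toRat MD + w ᵥ* toRat KD) = 0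
    rw [hw, ← add_assoc, add_neg_cancel]

lemma map_leftNullspace_blockSystemMatrix [Fintype μ] [DecidableEq ν]
    (hA : IsDualMinimalBasis KA NA)
    (hD : IsDualMinimalBasis KD ND) (hdet : (MA * NAᵀ).det ≠ 0) :
    (leftNullspace (toRat (systemMatrix (fromRows MA KA) (fromRows MB 0) (fromRows MC 0)
        (fromRows MD KD)))).map
      (LinearMap.funLeft (RatFunc F) (RatFunc F) (Sum.inr ∘ Sum.inl)) =
        leftNullspace (transferFunction (MA * NAᵀ) (MB * NDᵀ) (MC * NAᵀ) (MD * NDᵀ)) := by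
  rw [← map_funLeft_leftNullspace_systemMatrix hdet]
  ext x
  constructor
  · rintro ⟨v, hv, rfl⟩
    exact ⟨_, mem_leftNullspace_of_block hA.mul_transpose hD.mul_transpose hv, rfl⟩
  · rintro ⟨z, hz, rfl⟩
    exact exists_block_mem_leftNullspace hA hD hz

/-- Passing to the system matrix, `u = 0` forces `y₁ = 0`; what remains is `y₂ K_A = 0` and `w K_D =
0`, with independent rows. -/
lemma eq_zero_of_mem_leftNullspace_blockSystemMatrix [Fintype μ] [DecidableEq ν]
    (hA : IsDualMinimalBasis KA NA) (hD : IsDualMinimalBasis KD ND) (hdet : (MA * NAᵀ).det ≠ 0)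
    {v : (ν ⊕ κ) ⊕ (α ⊕ o) → RatFunc F}
    (hv : v ∈ leftNullspace (toRat (systemMatrix (fromRows MA KA) (fromRows MB 0)
      (fromRows MC 0) (fromRows MD KD))))
    (h : v ∘ Sum.inr ∘ Sum.inl = 0) : v = 0 := by
  have hz := eq_zero_of_mem_leftNullspace_systemMatrix hdet
    (mem_leftNullspace_of_block hA.mul_transpose hD.mul_transpose hv) h
  have hy : v ∘ Sum.inl ∘ Sum.inl = 0 := congrArg (· ∘ Sum.inl) hz
  obtain ⟨h1, h2⟩ := mem_leftNullspace_blockSystemMatrix.1 hv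
  simp only [hy, h, Matrix.zero_vecMul, zero_add] at h1 h2
  have hy' := hA.minimal_left.eq_zero_of_vecMul_toRat h1
  have hw := hD.minimal_left.eq_zero_of_vecMul_toRat h2
  ext ((i | i) | (i | i))
  · exact congrFun hy i
  · exact congrFun hy' i
  · exact congrFun h i
  · exact congrFun hw i

/-- A vector in the left null-space of the pencil is polynomial, of no larger degree, when its part
multiplying `-M_C` and `M_D` is. -/
lemma exists_toRatVec_of_mem_leftNullspace_blockSystemMatrix [Fintype μ] [IsAlgClosed F]
    (hKA : IsMinimalBasis KA) (hKD : IsMinimalBasis KD)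
    (hKA1 : ∀ i, rowDegree KA i = 1) (hKD1 : ∀ i, rowDegree KD i = 1)
    (hKNA : KA * NAᵀ = 0) (hKND : KD * NDᵀ = 0)
    (hMA : IsPencil MA) (hMB : IsPencil MB) (hMC : IsPencil MC) (hMD : IsPencil MD)
    (hfin : ∀ x : F, (fromCols (evalAt x (MA * NAᵀ)) (evalAt x (MB * NDᵀ))).rank =
      Fintype.card ν)
    (hinf : (fromCols (evalAt 0 (rev (matDegree NA + 1) (MA * NAᵀ)))
      (evalAt 0 (rev (matDegree ND + 1) (MB * NDᵀ)))).rank = Fintype.card ν)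
    {v : (ν ⊕ κ) ⊕ (α ⊕ o) → RatFunc F}
    (hv : v ∈ leftNullspace (toRat (systemMatrix (fromRows MA KA) (fromRows MB 0)
      (fromRows MC 0) (fromRows MD KD))))
    {q : α → F[X]} (hq : v ∘ Sum.inr ∘ Sum.inl = toRatVec q) :
    ∃ p : (ν ⊕ κ) ⊕ (α ⊕ o) → F[X], v = toRatVec p ∧
      ∀ d, (∀ j, (q j).natDegree ≤ d) → ∀ i, (p i).natDegree ≤ d := by
  obtain ⟨s1, s2⟩ := mem_leftNullspace_systemMatrix.1 (mem_leftNullspace_of_block hKNA hKND hv)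
  rw [Sum.elim_comp_inl, Sum.elim_comp_inr, hq] at s1 s2
  obtain ⟨y, hy, hydeg⟩ := exists_toRatVec_of_mem_leftNullspace_systemMatrix
    (hMA.natDegree_mul_transpose_le NA) (hMB.natDegree_mul_transpose_le ND)
    (hMC.natDegree_mul_transpose_le NA) (hMD.natDegree_mul_transpose_le ND) hfin hinf s1 s2
  obtain ⟨h1, h2⟩ := mem_leftNullspace_blockSystemMatrix.1 hv
  rw [hy, hq] at h1 h2
  -- Multiplying by the pencils `M` costs one degree, and dividing by `K_A` (below, by `K_D`)
  -- regains it.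
  obtain ⟨y', hy', hydeg'⟩ := hKA.exists_toRatVec_of_vecMul hKA1
    (v := v ∘ Sum.inl ∘ Sum.inr) (q := q ᵥ* MC - y ᵥ* MA) (by
      rw [toRatVec_sub, toRatVec_vecMul, toRatVec_vecMul, ← h1, add_sub_cancel_left])
  obtain ⟨w, hw, hwdeg⟩ := hKD.exists_toRatVec_of_vecMul hKD1
    (v := v ∘ Sum.inr ∘ Sum.inr) (q := -(y ᵥ* MB + q ᵥ* MD)) (by
      rw [toRatVec_neg, toRatVec_add, toRatVec_vecMul, toRatVec_vecMul]
      exact (neg_eq_of_add_eq_zero_right (by rw [add_assoc, h2])).symm)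
  refine ⟨Sum.elim (Sum.elim y y') (Sum.elim q w), ?_, fun d hd => ?_⟩
  · ext ((i | i) | (i | i))
    · exact congrFun hy i
    · exact congrFun hy' i
    · exact congrFun hq i
    · exact congrFun hw i
  · have hyd := hydeg d hd
    rintro ((i | i) | (i | i))
    · exact hyd i
    · refine hydeg' d (fun j => ?_) i
      exact (natDegree_sub_le_of_le (natDegree_vecMul_le hd fun k => hMC k j)
        (natDegree_vecMul_le hyd fun k => hMA k j)).trans_eq (max_self _)
    · exact hd i
    · refine hwdeg d (fun j => ?_) i
      rw [Pi.neg_apply, natDegree_neg]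
      exact natDegree_add_le_of_degree_le (natDegree_vecMul_le hyd fun k => hMB k j)
        (natDegree_vecMul_le hd fun k => hMD k j)

end

end RationalMatrix


theorem mainTheorem4 {F : Type*} [Field F] [IsAlgClosed F] {n m p kA kD : ℕ}
    -- the rational matrix `R = D + C A⁻¹ B`
    (A : Matrix (Fin n) (Fin n) (Polynomial F)) (B : Matrix (Fin n) (Fin m) (Polynomial F))
    (C : Matrix (Fin p) (Fin n) (Polynomial F)) (D : Matrix (Fin p) (Fin m) (Polynomial F))
    (hA : A.det ≠ 0)
    (R : Matrix (Fin p) (Fin m) (RatFunc F)) (hR : R = transferFunction A B C D)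
    -- the pencils `L_A = [M_A; K_A]` and `L_D = [M_D; K_D]`; their column index sets have
    -- `n + kA` and `m + kD` elements
    (MA : Matrix (Fin n) (Fin n ⊕ Fin kA) (Polynomial F))
    (KA : Matrix (Fin kA) (Fin n ⊕ Fin kA) (Polynomial F))
    (MD : Matrix (Fin p) (Fin m ⊕ Fin kD) (Polynomial F))
    (KD : Matrix (Fin kD) (Fin m ⊕ Fin kD) (Polynomial F))
    (hLA : IsStrongBlockMinimalBasisPencil MA KA) (hLD : IsStrongBlockMinimalBasisPencil MD KD)
    -- dual minimal bases, through which `L_A` and `L_D` are associated with `A` and `D`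
    (NA : Matrix (Fin n) (Fin n ⊕ Fin kA) (Polynomial F))
    (ND : Matrix (Fin m) (Fin m ⊕ Fin kD) (Polynomial F))
    (hNA : IsDualMinimalBasis KA NA) (hND : IsDualMinimalBasis KD ND)
    (hMA : MA * NA.transpose = A) (hMD : MD * ND.transpose = D)
    -- the linear polynomial matrices `M_B` and `M_C`
    (MB : Matrix (Fin n) (Fin m ⊕ Fin kD) (Polynomial F))
    (MC : Matrix (Fin p) (Fin n ⊕ Fin kA) (Polynomial F))
    (hMBlin : IsPencil MB) (hMClin : IsPencil MC)
    (hMB : MB * ND.transpose = B) (hMC : MC * NA.transpose = C)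
    -- the linear polynomial system matrix `𝓛` and its transfer function matrix
    (L : Matrix ((Fin n ⊕ Fin kA) ⊕ (Fin p ⊕ Fin kD)) ((Fin n ⊕ Fin kA) ⊕ (Fin m ⊕ Fin kD))
      (Polynomial F))
    (hL : L = systemMatrix (Matrix.fromRows MA KA) (Matrix.fromRows MB 0)
      (Matrix.fromRows MC 0) (Matrix.fromRows MD KD))
    (Rhat : Matrix (Fin p ⊕ Fin kD) (Fin m ⊕ Fin kD) (RatFunc F))
    (hRhat : Rhat = transferFunction (Matrix.fromRows MA KA) (Matrix.fromRows MB 0)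
      (Matrix.fromRows MC 0) (Matrix.fromRows MD KD))
    -- the two rank conditions
    (hfin : ∀ x : F, (Matrix.fromCols (evalAt x A) (evalAt x B)).rank = n)
    (hinf : (Matrix.fromCols (evalAt 0 (rev (matDegree NA + 1) A))
      (evalAt 0 (rev (matDegree ND + 1) B))).rank = n) :
    -- (a) each row of `Z` is `[y x]` with `x = [u w]`, where `x` is conformable with the rows
    -- of `Rhat` and `u` with the rows of `R`
    (∀ (t : ℕ) (Z : Matrix (Fin t) ((Fin n ⊕ Fin kA) ⊕ (Fin p ⊕ Fin kD)) (Polynomial F)),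
      IsLeftMinimalBasis (toRat L) Z →
        IsLeftMinimalBasis Rhat Z.toCols₂ ∧ IsLeftMinimalBasis R Z.toCols₂.toCols₁) ∧
    -- (b) the left minimal indices of `𝓛`, `Rhat` and `R` coincide
    (∀ (t : ℕ) (η : Fin t → ℕ),
      (IsLeftMinimalIndices (toRat L) η ↔ IsLeftMinimalIndices Rhat η) ∧
      (IsLeftMinimalIndices (toRat L) η ↔ IsLeftMinimalIndices R η)) := by
  subst hL hRhat hR hMA hMB hMC hMD
  have hpA : IsPencil MA := fun i => hLA.pencil (Sum.inl i)
  have hpD : IsPencil MD := fun i => hLD.pencil (Sum.inl i)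
  -- Recovery of the whole null vector from `u` alone, shared by both selections of coordinates.
  have hlift {v} (hv : v ∈ leftNullspace (toRat (systemMatrix (Matrix.fromRows MA KA)
      (Matrix.fromRows MB 0) (Matrix.fromRows MC 0) (Matrix.fromRows MD KD))))
      {q : Fin p → Polynomial F} (hq : v ∘ Sum.inr ∘ Sum.inl = toRatVec q) :=
    exists_toRatVec_of_mem_leftNullspace_blockSystemMatrix hLA.minimal hLD.minimal
      hLA.rowDegree_eq_one hLD.rowDegree_eq_one hNA.mul_transpose hND.mul_transpose hpA hMBlin
      hMClin hpD (by simpa using hfin) (by simpa using hinf) hv hq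
  have hR : IsDegreePreserving (leftNullspace (toRat (systemMatrix (Matrix.fromRows MA KA)
      (Matrix.fromRows MB 0) (Matrix.fromRows MC 0) (Matrix.fromRows MD KD))))
      (leftNullspace (transferFunction (MA * NA.transpose) (MB * ND.transpose)
        (MC * NA.transpose) (MD * ND.transpose))) (Sum.inr ∘ Sum.inl) :=
    ⟨map_leftNullspace_blockSystemMatrix hNA hND hA,
      fun _ hv h => eq_zero_of_mem_leftNullspace_blockSystemMatrix hNA hND hA hv h,
      fun _ hv _ hq => hlift hv hq⟩
  have hdet := det_fromRows_ne_zero hNA hA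
  have hRhat : IsDegreePreserving (leftNullspace (toRat (systemMatrix (Matrix.fromRows MA KA)
      (Matrix.fromRows MB 0) (Matrix.fromRows MC 0) (Matrix.fromRows MD KD))))
      (leftNullspace (transferFunction (Matrix.fromRows MA KA) (Matrix.fromRows MB 0)
        (Matrix.fromRows MC 0) (Matrix.fromRows MD KD))) Sum.inr :=
    ⟨map_funLeft_leftNullspace_systemMatrix hdet _ _ _,
      fun _ hv h => eq_zero_of_mem_leftNullspace_systemMatrix hdet hv h,
      fun v hv q hq => by
        -- Only the `u` part of `x` is used: a degree bound on `x` also bounds `u`.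
        obtain ⟨r, hr, hdeg⟩ := hlift hv (q := q ∘ Sum.inl) (congrArg (· ∘ Sum.inl) hq)
        exact ⟨r, hr, fun d hd => hdeg d fun j => hd (Sum.inl j)⟩⟩
  exact ⟨fun t Z hZ => ⟨hRhat.isMinimalBasisOf_submatrix hZ, hR.isMinimalBasisOf_submatrix hZ⟩,
    fun t η => ⟨hRhat.isMinimalIndices_iff η, hR.isMinimalIndices_iff η⟩⟩
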